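/- **Model.** $n$ asynchronous crash-prone processes communicate through atomic shared objects. Each step of a process is the invocation of an operation, one access to a shared object, or the response of an operation; an execution is a finite or infinite sequence of steps, with no fairness assumption. A *$k$-multiplicative-accurate Counter* has operations Increment and Read; in every legal sequence of operations each Read returns some $x$ with $v/k \le x \le kv$, where $v$ is the number of preceding Increments. It is *$m$-bounded* if attention is restricted to executions with at most $m$ Increments. An execution is *linearizable* if all its completed operations, with their responses, and some of its incomplete operations, with suitable responses, can be arranged in a legal sequence that respects the order of non-overlapping operations. *Wait-free* means that in every execution a process that takes infinitely many steps completes infinitely many operations. A *max-register* has operations MaxWrite$(v)$ and MaxRead; MaxRead returns the maximum of the initial value and of all values written before. It is *$h$-bounded* if no value above $h$ is written. **Algorithm.** The processes share one max-register $R$ with initial value $-1$. Each process has persistent local variables $lcounter = 0$, $threshold = 1$, $nextVal = 0$ (initial values). * Increment: $lcounter \gets lcounter + 1$; if then $lcounter = threshold$: MaxWrite $nextVal$ to $R$, set $nextVal \gets nextVal+1$ and $lcounter \gets 0$, and if now $nextVal \ge 2$, set $threshold \gets 2 \cdot threshold$. * Read: MaxRead $r$ from $R$; return $k\cdot 2^r$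 if $r \ge 0$, and $0$ otherwise. For a given $m$, let $h = \lceil \log_2 m\rceil$ (and $h = 0$ for $m = 0$). $R$ is implemented from one-bit read-write registers, initially $0$, by the max-register of Aspnes, Attiya and Censor-Hillel: the value $v \in \{-1,\dots,h\}$ is stored as $v+1$ in a complete binary tree of depth $d = \lceil \log_2 (h+2)\rceil$, where a tree of depth $0$ stores only $0$, and a tree of depth $j+1$ consists of a one-bit *switch* and a left and a right subtree of depth $j$. To write $w < 2^j$ to it, read the switch, and if it is $0$, write $w$ to the left subtree; to write $w \ge 2^j$, write $w - 2^j$ to the right subtree and then set the switch to $1$. To read it, read the switch; if it is $0$, return the value read from the left subtree, otherwise $2^j$ plus the value read from the right subtree. **Theorem.** There is an absolute constant $C$ such that for all natural numbers $n$ and $m$ and every real $k \ge \sqrt{2n}$: 1. the algorithm, with $R$ implemented from read-write registers as above, is a linearizable implementation, for $n$ processes, of a $k$-multiplicative-accurate $m$-bounded Counter; 2. it is wait-free; 3. every Read and every Increment takes $O(\log\log m)$ steps on the registers: at most $C\cdot\max\{1, \log_2\log_2 m\}$ (where $\log_2 \log_2 m$ is replaced by $0$ for $m \le 1$); 4. in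 every execution of the algorithm on an atomic max-register with at most $m$ Increments, $R$ is used as a $\lceil\log_2 m\rceil$-bounded max-register (with $\lceil \log_2 0\rceil := 0$), and each process only MaxWrites values $j \in \{0,1,2,\dots\}$, the value $j$ during its $2^j$-th Increment. -/

import Mathlib

namespace ApproxCounter

/-! ### Shared memory, sequential programs and implementations -/

/-- An atomic (instantaneous) deterministic shared memory: the operations on it, the type of the
value that each operation returns, its states, its initial state, and the effect of an operation. -/
structure SharedMemory where
  Op : Type
  Ret : Op → Type
  State : Type
  init : State
  apply : (o : Op) → State → Ret o × State

/-- Sequential code that accesses the shared memory `M` and returns a value of type `α`. -/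
inductive Prog (M : SharedMemory) (α : Type) : Type
  | pure (a : α) : Prog M α
  | call (o : M.Op) (cont : M.Ret o → Prog M α) : Prog M α

namespace Prog

variable {M M' : SharedMemory} {α β : Type}

/-- Sequential composition. -/
def bind : Prog M α → (α → Prog M β) → Prog M β
  | pure a, f => f a
  | call o cont, f => call o (fun x => (cont x).bind f)

/-- Local post-processing of the returned value. -/
def map (f : α → β) (c : Prog M α) : Prog M β := c.bind (fun a => pure (f a))

/-- Replace every access to `M` by a call of a procedure that runs on the memory `M'`. -/
def subst (proc : (o : M.Op) → Prog M' (M.Ret o)) : Prog M α → Prog M' α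
  | pure a => pure a
  | call o cont => (proc o).bind (fun x => (cont x).subst proc)

end Prog

/-- What a process does next inside an operation: one access to the shared memory, or the response
of the operation (which also fixes the new values of the persistent local variables). -/
inductive Action (M : SharedMemory) (Res Local Code : Type) : Type
  | access (o : M.Op) (cont : M.Ret o → Code) : Action M Res Local Code
  | respond (r : Res) (l : Local) : Action M Res Local Code

/-- An implementation, from the shared memory `M`, of an object with invocations `Inv` and
responses `Res`. `Local` holds the persistent local variables of a process, `Code` the control
states inside an operation. Nothing here forces an operation to terminate. -/
structure Implementation (M : SharedMemory) (Inv Res : Type) where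
  Local : Type
  init : Local
  Code : Type
  start : Inv → Local → Code
  next : Code → Action M Res Local Code

/-- The implementation in which each invocation runs the given sequential program. -/
def Implementation.ofProg {M : SharedMemory} {Inv Res : Type} (Local : Type) (init : Local)
    (prog : Inv → Local → Prog M (Res × Local)) : Implementation M Inv Res where
  Local := Local
  init := init
  Code := Prog M (Res × Local)
  start := prog
  next
    | .pure (r, l) => .respond r l
    | .call o cont => .access o cont

/-! ### Executions -/

/-- A step of a process: an invocation, an access to the shared memory, or a response. -/
inductive Event (n : ℕ) (M : SharedMemory) (Inv Res : Type) : Type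
  | invoke (p : Fin n) (i : Inv) : Event n M Inv Res
  | access (p : Fin n) (o : M.Op) : Event n M Inv Res
  | respond (p : Fin n) (r : Res) : Event n M Inv Res

/-- The process that takes the step. -/
def Event.proc {n : ℕ} {M : SharedMemory} {Inv Res : Type} : Event n M Inv Res → Fin n
  | .invoke p _ => p
  | .access p _ => p
  | .respond p _ => p

section Executions

variable {M : SharedMemory} {Inv Res : Type}

/-- A process is between two operations, or inside an operation. -/
inductive Status (A : Implementation M Inv Res) : Type
  | idle (l : A.Local) : Status A
  | busy (c : A.Code) : Status A

/-- A configuration of a system of `n` processes. -/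
structure Config (A : Implementation M Inv Res) (n : ℕ) where
  mem : M.State
  status : Fin n → Status A

/-- The initial configuration. -/
def Config.initial (A : Implementation M Inv Res) (n : ℕ) : Config A n where
  mem := M.init
  status := fun _ => .idle A.init

/-- `Step c e c'`: in configuration `c` the step `e` is possible and leads to `c'`. -/
inductive Step {A : Implementation M Inv Res} {n : ℕ} :
    Config A n → Event n M Inv Res → Config A n → Prop
  | invoke (c : Config A n) (p : Fin n) (i : Inv) (l : A.Local)
      (h : c.status p = .idle l) :
      Step c (.invoke p i) ⟨c.mem, Function.update c.status p (.busy (A.start i l))⟩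
  | access (c : Config A n) (p : Fin n) (s : A.Code) (o : M.Op) (cont : M.Ret o → A.Code)
      (h : c.status p = .busy s) (hs : A.next s = .access o cont) :
      Step c (.access p o)
        ⟨(M.apply o c.mem).2, Function.update c.status p (.busy (cont (M.apply o c.mem).1))⟩
  | respond (c : Config A n) (p : Fin n) (s : A.Code) (r : Res) (l : A.Local)
      (h : c.status p = .busy s) (hs : A.next s = .respond r l) :
      Step c (.respond p r) ⟨c.mem, Function.update c.status p (.idle l)⟩

/-- A finite or infinite execution by `n` asynchronous crash-prone processes. At each time at most
one step is taken; `event t = none` means that no step is taken at time `t` (so a finite execution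
is one with finitely many steps). No fairness is assumed. -/
structure Execution (A : Implementation M Inv Res) (n : ℕ) where
  config : ℕ → Config A n
  event : ℕ → Option (Event n M Inv Res)
  config_zero : config 0 = Config.initial A n
  step_some : ∀ t e, event t = some e → Step (config t) e (config (t + 1))
  step_none : ∀ t, event t = none → config (t + 1) = config t

namespace Execution

variable {A : Implementation M Inv Res} {n : ℕ}

/-- The operation invoked at time `t` responds at time `s` with `r`. An operation instance is
identified with the time of its invocation. -/
def Completes (E : Execution A n) (t s : ℕ) (r : Res) : Prop :=
  ∃ p i, E.event t = some (.invoke p i) ∧ t < s ∧ E.event s = some (.respond p r) ∧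
    ∀ u, t < u → u < s → ∀ r', E.event u ≠ some (.respond p r')

/-- The times of the steps of the operation of process `p` that is invoked at time `t`, from its
invocation up to its response (if any), both included. -/
def opSteps (E : Execution A n) (p : Fin n) (t : ℕ) : Set ℕ :=
  {u | t ≤ u ∧ (∃ e, E.event u = some e ∧ e.proc = p) ∧
    ∀ w, t < w → w < u → ∀ r, E.event w ≠ some (.respond p r)}

/-- `E` is linearizable with respect to a sequential specification (the set of legal finite
sequences of operations with their responses).

`L` is the linearization: `L j = some t` means that slot `j` holds the operation invoked at time
`t` (slots may stay empty); `lab t` is the invocation of that operation with its response. All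
completed operations occur, with the responses that they have in `E`; incomplete operations may
occur, with any response. The order of non-overlapping operations is respected, and every finite
initial segment is legal. -/
def IsLinearizable (E : Execution A n) (spec : List (Inv × Res) → Prop) : Prop :=
  ∃ (L : ℕ → Option ℕ) (lab : ℕ → Inv × Res),
    (∀ j t, L j = some t → ∃ p, E.event t = some (.invoke p (lab t).1)) ∧
    (∀ i j t, L i = some t → L j = some t → i = j) ∧
    (∀ t s r, E.Completes t s r → (∃ j, L j = some t) ∧ (lab t).2 = r) ∧
    (∀ t₁ s r t₂ i j, E.Completes t₁ s r → s < t₂ → L i = some t₁ → L j = some t₂ → i < j) ∧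
    (∀ N, spec (((List.range N).filterMap L).map lab))

end Execution

/-- Wait-freedom: in every execution, a process that takes infinitely many steps completes
infinitely many operations. -/
def Implementation.IsWaitFree (A : Implementation M Inv Res) (n : ℕ) : Prop :=
  ∀ (E : Execution A n) (p : Fin n),
    {t | ∃ e, E.event t = some e ∧ e.proc = p}.Infinite →
      {t | ∃ r, E.event t = some (.respond p r)}.Infinite

/-- Every operation instance (complete or not) takes at most `B` steps in every execution. -/
def Implementation.StepsAtMost (A : Implementation M Inv Res) (n : ℕ) (B : ℝ) : Prop :=
  ∀ (E : Execution A n) (p : Fin n) (i : Inv) (t : ℕ), E.event t = some (.invoke p i) →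
    (E.opSteps p t).Finite ∧ ((E.opSteps p t).ncard : ℝ) ≤ B

end Executions

/-! ### The approximate counter -/

inductive CounterInv : Type
  | increment : CounterInv
  | read : CounterInv

inductive CounterRes : Type
  | ack : CounterRes
  | value (x : ℝ) : CounterRes

/-- Number of Increments in a sequence of operations. -/
def numIncrements : List (CounterInv × CounterRes) → ℕ
  | [] => 0
  | (.increment, _) :: l => numIncrements l + 1
  | (.read, _) :: l => numIncrements l

/-- Sequential specification of the `k`-multiplicative-accurate Counter: each Read returns some `x`
with `v / k ≤ x ≤ k * v`, where `v` is the number of preceding Increments. -/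
def CounterSpec (k : ℝ) (l : List (CounterInv × CounterRes)) : Prop :=
  ∀ j (hj : j < l.length),
    match l[j] with
    | (.increment, res) => res = .ack
    | (.read, res) => ∃ x : ℝ, res = .value x ∧
        (numIncrements (l.take j) : ℝ) / k ≤ x ∧ x ≤ k * (numIncrements (l.take j) : ℝ)

/-- At most `m` Increments are invoked in the execution. -/
def Execution.IncrementsAtMost {M : SharedMemory}
    {A : Implementation M CounterInv CounterRes} {n : ℕ} (E : Execution A n) (m : ℕ) : Prop :=
  {t | ∃ p, E.event t = some (.invoke p .increment)}.encard ≤ m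

/-- `A` is a linearizable implementation, for `n` processes, of a `k`-multiplicative-accurate
`m`-bounded Counter: attention is restricted to executions with at most `m` Increments. -/
def IsLinearizableBoundedCounter {M : SharedMemory} (A : Implementation M CounterInv CounterRes)
    (n : ℕ) (k : ℝ) (m : ℕ) : Prop :=
  ∀ E : Execution A n, E.IncrementsAtMost m → E.IsLinearizable (CounterSpec k)

/-! ### The counter algorithm, on one max-register -/

inductive MaxRegOp : Type
  | maxRead : MaxRegOp
  | maxWrite (v : ℤ) : MaxRegOp

/-- One atomic max-register with initial value `-1`. -/
def maxRegister : SharedMemory where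
  Op := MaxRegOp
  Ret
    | .maxRead => ℤ
    | .maxWrite _ => Unit
  State := ℤ
  init := -1
  apply
    | .maxRead, s => (s, s)
    | .maxWrite v, s => ((), max s v)

/-- The persistent local variables of a process. -/
structure LocalVars where
  lcounter : ℕ
  threshold : ℕ
  nextVal : ℕ

def LocalVars.initial : LocalVars where
  lcounter := 0
  threshold := 1
  nextVal := 0

/-- Increment: `lcounter++`; if `lcounter = threshold` then MaxWrite `nextVal`, `nextVal++`,
`lcounter ← 0`, and if now `nextVal ≥ 2` then `threshold ← 2 * threshold`. -/
def incrementProg (s : LocalVars) : Prog maxRegister (CounterRes × LocalVars) :=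
  if s.lcounter + 1 = s.threshold then
    .call (.maxWrite s.nextVal) fun _ =>
      .pure (.ack,
        { lcounter := 0
          threshold := if 2 ≤ s.nextVal + 1 then 2 * s.threshold else s.threshold
          nextVal := s.nextVal + 1 })
  else
    .pure (.ack, { s with lcounter := s.lcounter + 1 })

/-- Read: MaxRead `r`; return `k * 2 ^ r` if `r ≥ 0`, and `0` otherwise. -/
noncomputable def readProg (k : ℝ) (s : LocalVars) : Prog maxRegister (CounterRes × LocalVars) :=
  .call .maxRead fun (r : ℤ) =>
    .pure (.value (if 0 ≤ r then k * (2 : ℝ) ^ r else 0), s)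

/-- The code of the counter algorithm. -/
noncomputable def counterProg (k : ℝ) :
    CounterInv → LocalVars → Prog maxRegister (CounterRes × LocalVars)
  | .increment, s => incrementProg s
  | .read, s => readProg k s

/-- The counter algorithm on an atomic max-register. -/
noncomputable def counterOnMaxRegister (k : ℝ) :
    Implementation maxRegister CounterInv CounterRes :=
  .ofProg LocalVars .initial (counterProg k)

/-! ### Bounded max-registers from one-bit read-write registers -/

inductive RegOp (X : Type) : Type
  | read (x : X) : RegOp X
  | write (x : X) (b : Bool) : RegOp X

/-- An array, indexed by `X`, of atomic one-bit multi-reader multi-writer read-write registers, all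
initially `false`. -/
def registers (X : Type) [DecidableEq X] : SharedMemory where
  Op := RegOp X
  Ret
    | .read _ => Bool
    | .write _ _ => Unit
  State := X → Bool
  init := fun _ => false
  apply
    | .read x, s => (s x, s)
    | .write x b, s => ((), Function.update s x b)

/-- The inner nodes of the complete binary tree of depth `d`: for `d + 1`, the root is `none`, and
`some (false, x)` and `some (true, x)` are the nodes of the left and of the right subtree. -/
def Node : ℕ → Type
  | 0 => Empty
  | d + 1 => Option (Bool × Node d)

instance Node.instDecidableEq : (d : ℕ) → DecidableEq (Node d)
  | 0 => inferInstanceAs (DecidableEq Empty)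
  | d + 1 =>
    haveI := Node.instDecidableEq d
    inferInstanceAs (DecidableEq (Option (Bool × Node d)))

section Tree

variable {X : Type} [DecidableEq X]

/-- MaxRead of the tree max-register of depth `d` (values `0, …, 2 ^ d - 1`), whose switch at node
`x` is the register `sw x`: read the switch of the root, continue in the right subtree if it is
set, and in the left subtree otherwise. -/
def treeMaxRead : (d : ℕ) → (sw : Node d → X) → Prog (registers X) ℕ
  | 0, _ => .pure 0
  | d + 1, sw =>
    .call (.read (sw none)) fun (b : Bool) =>
      if b then
        (treeMaxRead d (fun x => sw (some (true, x)))).map (fun a => a + 2 ^ d)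
      else
        treeMaxRead d (fun x => sw (some (false, x)))

/-- MaxWrite of `v`: a value of the right half is written to the right subtree, and then the switch
of the root is set; a value of the left half is written to the left subtree, unless the switch of
the root is found to be set. -/
def treeMaxWrite : (d : ℕ) → (sw : Node d → X) → ℕ → Prog (registers X) Unit
  | 0, _, _ => .pure ()
  | d + 1, sw, v =>
    if v < 2 ^ d then
      .call (.read (sw none)) fun (b : Bool) =>
        if b then .pure () else treeMaxWrite d (fun x => sw (some (false, x))) v
    else
      (treeMaxWrite d (fun x => sw (some (true, x))) (v - 2 ^ d)).bind fun _ =>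
        .call (.write (sw none) true) fun _ => .pure ()

end Tree

/-- The depth of the tree for an `h`-bounded max-register with initial value `-1`, that is, for the
`h + 2` values `-1, 0, …, h`. -/
def treeDepth (h : ℕ) : ℕ := Nat.clog 2 (h + 2)

/-- The `h`-bounded max-register with initial value `-1` from one-bit registers: the value `v` is
stored as `v + 1` in the tree. -/
def maxRegisterProc (h : ℕ) :
    (o : maxRegister.Op) → Prog (registers (Node (treeDepth h))) (maxRegister.Ret o)
  | .maxRead => (treeMaxRead (treeDepth h) id).map (fun a : ℕ => (a : ℤ) - 1)
  | .maxWrite v => treeMaxWrite (treeDepth h) id (v + 1).toNat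

/-- The counter algorithm for at most `m` Increments out of one-bit read-write registers: its
max-register is the `⌈log₂ m⌉`-bounded one above. -/
noncomputable def counterOnRegisters (k : ℝ) (m : ℕ) :
    Implementation (registers (Node (treeDepth (Nat.clog 2 m)))) CounterInv CounterRes :=
  .ofProg LocalVars .initial
    (fun i s => (counterProg k i s).subst (maxRegisterProc (Nat.clog 2 m)))

end ApproxCounter

open ApproxCounter

namespace ApproxCounter

namespace Prog

variable {M : SharedMemory} {α β : Type}

/-- Rely-guarantee correctness of the program from a given state: if the steps of the other
processes are contained in `R`, then all accesses of the program satisfy `G`, and the returned value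
and the memory satisfy `Q`, at and after the last access. -/
def Meets (R : M.State → M.State → Prop) (G : M.Op → Prop) (Q : α → M.State → Prop) :
    Prog M α → M.State → Prop
  | pure a, s => ∀ s', R s s' → Q a s'
  | call o cont, s =>
    G o ∧ ∀ s', R s s' → Meets R G Q (cont (M.apply o s').1) (M.apply o s').2

theorem Meets.of_rely {R : M.State → M.State → Prop} (hR : ∀ s₁ s₂ s₃, R s₁ s₂ → R s₂ s₃ → R s₁ s₃)
    {G : M.Op → Prop} {Q : α → M.State → Prop} {c : Prog M α} {s s' : M.State}
    (h : c.Meets R G Q s) (hs : R s s') : c.Meets R G Q s' := by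
  cases c with
  | pure a => exact fun s'' h'' => h s'' (hR _ _ _ hs h'')
  | call o cont => exact ⟨h.1, fun s'' h'' => h.2 s'' (hR _ _ _ hs h'')⟩

theorem Meets.mono {R : M.State → M.State → Prop} {G : M.Op → Prop} {Q Q' : α → M.State → Prop}
    (hQ : ∀ a s, Q a s → Q' a s) {c : Prog M α} {s : M.State} (h : c.Meets R G Q s) :
    c.Meets R G Q' s := by
  induction c generalizing s with
  | pure a => exact fun s' h' => hQ _ _ (h s' h')
  | call o cont ih => exact ⟨h.1, fun s' h' => ih _ (h.2 s' h')⟩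

theorem Meets.bind {R : M.State → M.State → Prop} (hR : ∀ s, R s s) {G : M.Op → Prop}
    {Q : β → M.State → Prop} {f : α → Prog M β} {c : Prog M α} {s : M.State}
    (h : c.Meets R G (fun a => (f a).Meets R G Q) s) : (c.bind f).Meets R G Q s := by
  induction c generalizing s with
  | pure a => exact h s (hR s)
  | call o cont ih => exact ⟨h.1, fun s' h' => ih _ (h.2 s' h')⟩

/-- Every run of the program makes at most the given number of accesses. -/
def CallsAtMost : Prog M α → ℕ → Prop
  | pure _, _ => True
  | call _ _, 0 => False
  | call _ cont, N + 1 => ∀ x, CallsAtMost (cont x) N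

theorem CallsAtMost.mono {c : Prog M α} {N N' : ℕ} (h : c.CallsAtMost N) (hN : N ≤ N') :
    c.CallsAtMost N' := by
  induction c generalizing N N' with
  | pure a => trivial
  | call o cont ih =>
    obtain _ | N := N
    · exact h.elim
    · obtain ⟨N', rfl⟩ : ∃ N'', N' = N'' + 1 := ⟨N' - 1, by omega⟩
      exact fun x => ih x (h x) (by omega)

theorem CallsAtMost.bind {c : Prog M α} {f : α → Prog M β} {a b : ℕ} (h : c.CallsAtMost a)
    (hf : ∀ x, (f x).CallsAtMost b) : (c.bind f).CallsAtMost (a + b) := by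
  induction c generalizing a with
  | pure x => exact (hf x).mono (by omega)
  | call o cont ih =>
    obtain _ | a := a
    · exact h.elim
    · rw [show a + 1 + b = (a + b) + 1 by omega]
      exact fun x => ih x (h x)

end Prog

/-! ### The tree max-register -/

/-- The value of the tree max-register in a given state: what a MaxRead without interference
returns. -/
def treeVal : (d : ℕ) → (Node d → Bool) → ℕ
  | 0, _ => 0
  | d + 1, s =>
    if s none then treeVal d (fun x => s (some (true, x))) + 2 ^ d
    else treeVal d (fun x => s (some (false, x)))

/-- The least value that is stored to the right of the switch at an inner node. -/
def nodeMin : (d : ℕ) → Node d → ℕ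
  | 0, _ => 0
  | d + 1, none => 2 ^ d
  | d + 1, some (true, x) => nodeMin d x + 2 ^ d
  | d + 1, some (false, x) => nodeMin d x

theorem treeVal_lt (d : ℕ) (s : Node d → Bool) : treeVal d s < 2 ^ d := by
  induction d with
  | zero => simp [treeVal]
  | succ d ih =>
    have h1 := ih (fun x => s (some (true, x)))
    have h2 := ih (fun x => s (some (false, x)))
    rw [treeVal, pow_succ]
    split <;> omega

theorem treeVal_mono (d : ℕ) {s s' : Node d → Bool} (h : ∀ x, s x = true → s' x = true) :
    treeVal d s ≤ treeVal d s' := by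
  induction d with
  | zero => simp [treeVal]
  | succ d ih =>
    have h1 := ih (s := fun x => s (some (true, x))) (s' := fun x => s' (some (true, x)))
      (fun x => h _)
    have h2 := ih (s := fun x => s (some (false, x))) (s' := fun x => s' (some (false, x)))
      (fun x => h _)
    have h3 := treeVal_lt d (fun x => s (some (false, x)))
    have h4 := h none
    rw [treeVal, treeVal]
    split_ifs <;> first | omega | simp_all

/-- A positive value is due to a switch that is set. -/
theorem exists_nodeMin_of_treeVal_pos (d : ℕ) {s : Node d → Bool} (h : 0 < treeVal d s) :
    ∃ x, s x = true ∧ treeVal d s ≤ nodeMin d x := by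
  induction d with
  | zero => simp [treeVal] at h
  | succ d ih =>
    rw [treeVal] at h ⊢
    split_ifs at h ⊢ with hn
    · by_cases h0 : 0 < treeVal d (fun x => s (some (true, x)))
      · obtain ⟨x, hx, hx'⟩ := ih h0
        exact ⟨some (true, x), hx, by simpa [nodeMin] using hx'⟩
      · exact ⟨none, hn, by simp only [nodeMin]; omega⟩
    · obtain ⟨x, hx, hx'⟩ := ih h
      exact ⟨some (false, x), hx, by simpa [nodeMin] using hx'⟩

section Tree

variable {X : Type} [DecidableEq X]

/-- Some registers are set, and none is reset. -/
def Grows (s s' : (registers X).State) : Prop :=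
  ∀ x : X, (s : X → Bool) x = true → (s' : X → Bool) x = true

theorem Grows.refl (s : (registers X).State) : Grows s s := fun _ h => h

theorem Grows.trans (s₁ s₂ s₃ : (registers X).State) (h : Grows s₁ s₂) (h' : Grows s₂ s₃) :
    Grows s₁ s₃ := fun x hx => h' x (h x hx)

theorem Grows.update (s : X → Bool) (x : X) :
    Grows (X := X) s (Function.update s x true) := by
  intro y hy
  rcases eq_or_ne y x with rfl | hne
  · exact Function.update_self ..
  · exact (Function.update_of_ne hne ..).trans hy

theorem treeVal_le_of_grows {d : ℕ} (sw : Node d → X) {s s' : X → Bool}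
    (h : Grows (X := X) s s') :
    treeVal d (fun x => s (sw x)) ≤ treeVal d (fun x => s' (sw x)) :=
  treeVal_mono d fun _ => h _

theorem meets_treeMaxRead {G : RegOp X → Prop} (hG : ∀ x, G (.read x)) (d : ℕ) (sw : Node d → X)
    (s : X → Bool) :
    (treeMaxRead d sw).Meets Grows G
      (fun a s' => treeVal d (fun x => s (sw x)) ≤ a ∧
        a ≤ treeVal d (fun x => (s' : X → Bool) (sw x)) ∧ Grows s s') s := by
  induction d generalizing s with
  | zero => exact fun _ h => ⟨le_rfl, le_rfl, h⟩
  | succ d ih =>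
    rw [treeMaxRead]
    refine ⟨hG _, fun (s' : X → Bool) hs' => ?_⟩
    have hmono := treeVal_le_of_grows sw hs'
    change Prog.Meets (M := registers X) _ _ _ (if s' (sw none) then _ else _) s'
    split_ifs with hb
    · refine Prog.Meets.bind Grows.refl ((ih (fun x => sw (some (true, x))) s').mono ?_)
      rintro a (s₁ : X → Bool) ⟨h1, h2, hg⟩ (s₂ : X → Bool) hs₂
      have h3 := treeVal_le_of_grows (fun x => sw (some (true, x))) hs₂
      have h4 : s₂ (sw none) = true := hs₂ _ (hg _ hb)
      simp only [treeVal, hb, h4, if_true] at hmono ⊢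
      exact ⟨by omega, by omega, Grows.trans _ _ _ hs' (Grows.trans _ _ _ hg hs₂)⟩
    · refine (ih (fun x => sw (some (false, x))) s').mono ?_
      rintro a (s₁ : X → Bool) ⟨h1, h2, hg⟩
      have h3 : treeVal d (fun x => s₁ (sw (some (false, x)))) < 2 ^ d := treeVal_lt d _
      simp only [treeVal, hb] at hmono ⊢
      refine ⟨by simpa using hmono.trans h1, ?_, Grows.trans _ _ _ hs' hg⟩
      split_ifs <;> omega

theorem meets_treeMaxWrite {G : RegOp X → Prop} (hG : ∀ x, G (.read x)) (d : ℕ) (sw : Node d → X)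
    (v : ℕ) (hv : v < 2 ^ d) (hGv : ∀ y, nodeMin d y ≤ v → G (.write (sw y) true))
    (s : X → Bool) :
    (treeMaxWrite d sw v).Meets Grows G
      (fun _ s' => v ≤ treeVal d (fun x => (s' : X → Bool) (sw x))) s := by
  induction d generalizing s v with
  | zero => exact fun _ _ => by simp [treeVal]; omega
  | succ d ih =>
    rw [treeMaxWrite]
    split_ifs with hvd
    · refine ⟨hG _, fun (s' : X → Bool) hs' => ?_⟩
      change Prog.Meets (M := registers X) _ _ _ (if s' (sw none) then _ else _) s'
      split_ifs with hb
      · intro (s₁ : X → Bool) hs₁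
        have h4 : s₁ (sw none) = true := hs₁ _ hb
        simp only [treeVal, h4, if_true]
        omega
      · refine (ih (fun x => sw (some (false, x))) v hvd (fun y hy => hGv _ hy) s').mono ?_
        intro _ (s₁ : X → Bool) h1
        simp only [treeVal]
        split_ifs <;> omega
    · rw [pow_succ] at hv
      refine Prog.Meets.bind Grows.refl ((ih (fun x => sw (some (true, x))) (v - 2 ^ d) (by omega)
        (fun y hy => hGv _ (by rw [nodeMin]; omega)) s).mono ?_)
      intro _ (s₁ : X → Bool) h1
      refine ⟨hGv none (by rw [nodeMin]; omega), fun (s₂ : X → Bool) hs₂ (s₃ : X → Bool) hs₃ => ?_⟩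
      have h4 : s₃ (sw none) = true := 
        hs₃ _ (show Function.update s₂ (sw none) true (sw none) = true from Function.update_self ..)
      have h5 := treeVal_le_of_grows (fun x => sw (some (true, x)))
        (hs₂.trans _ _ _ ((Grows.update s₂ (sw none)).trans _ _ _ hs₃))
      simp only [treeVal, h4, if_true]
      omega

theorem callsAtMost_treeMaxRead (d : ℕ) (sw : Node d → X) :
    (treeMaxRead d sw).CallsAtMost d := by
  induction d with
  | zero => trivial
  | succ d ih =>
    intro b
    dsimp only
    split_ifs
    · exact (ih _).bind (b := 0) fun _ => trivial
    · exact ih _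

theorem callsAtMost_treeMaxWrite (d : ℕ) (sw : Node d → X) (v : ℕ) :
    (treeMaxWrite d sw v).CallsAtMost d := by
  induction d generalizing v with
  | zero => trivial
  | succ d ih =>
    rw [treeMaxWrite]
    split_ifs
    · intro b
      dsimp only
      split_ifs
      · trivial
      · exact ih _ _
    · exact (ih _ _).bind (b := 1) fun _ _ => trivial

end Tree

section Verification

variable {M : SharedMemory} {Inv Res Local : Type} {init : Local} {n : ℕ}

/-- The possible kinds of a point of time in an execution of sequential programs. -/
theorem Execution.cases_at {prog : Inv → Local → Prog M (Res × Local)}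
    (E : Execution (.ofProg Local init prog) n) (u : ℕ) :
    (E.event u = none ∧ E.config (u + 1) = E.config u) ∨
    (∃ p i l, E.event u = some (.invoke p i) ∧ (E.config u).status p = .idle l ∧
      (E.config (u + 1)).mem = (E.config u).mem ∧
      (E.config (u + 1)).status = Function.update (E.config u).status p (.busy (prog i l))) ∨
    (∃ p o cont, E.event u = some (.access p o) ∧
      (E.config u).status p = .busy (Prog.call o cont) ∧
      (E.config (u + 1)).mem = (M.apply o (E.config u).mem).2 ∧
      (E.config (u + 1)).status =
        Function.update (E.config u).status p (.busy (cont (M.apply o (E.config u).mem).1))) ∨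
    (∃ p r l, E.event u = some (.respond p r) ∧
      (E.config u).status p = .busy (Prog.pure (r, l)) ∧
      (E.config (u + 1)).mem = (E.config u).mem ∧
      (E.config (u + 1)).status = Function.update (E.config u).status p (.idle l)) := by
  rcases he : E.event u with _ | e
  · exact .inl ⟨rfl, E.step_none u he⟩
  · refine .inr ?_
    have hstep := E.step_some u e he
    generalize hc : E.config u = c at hstep ⊢
    generalize hc' : E.config (u + 1) = c' at hstep ⊢
    cases hstep with
    | invoke p i l h => exact .inl ⟨p, i, l, rfl, h, rfl, rfl⟩
    | access p s o cont h hs =>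
      refine .inr (.inl ?_)
      obtain ⟨r, l⟩ | ⟨o', cont'⟩ := (s : Prog M (Res × Local))
      · exact absurd hs (by simp [Implementation.ofProg])
      · cases show (Action.access o' cont' : Action M Res Local (Prog M (Res × Local))) =
          .access o cont from hs
        exact ⟨p, _, _, rfl, h, rfl, rfl⟩
    | respond p s r l h hs =>
      refine .inr (.inr ?_)
      obtain ⟨r', l'⟩ | ⟨o', cont'⟩ := (s : Prog M (Res × Local))
      · cases show (Action.respond r' l' : Action M Res Local (Prog M (Res × Local))) =
          .respond r l from hs
        exact ⟨p, _, _, rfl, h, rfl, rfl⟩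
      · exact absurd hs (by simp [Implementation.ofProg])

/-- The operation of `p` invoked at time `t` is still running at time `u`. -/
def Execution.Running {A : Implementation M Inv Res} (E : Execution A n) (p : Fin n) (t u : ℕ) :
    Prop :=
  t < u ∧ ∀ w, t < w → w < u → ∀ r, E.event w ≠ some (.respond p r)

end Verification

section Counter

variable {M : SharedMemory} {Local : Type} {init : Local} {n : ℕ}

open Classical in
/-- The number of Increments that `p` has invoked before time `u`. -/
noncomputable def Execution.numInc {A : Implementation M CounterInv CounterRes}
    (E : Execution A n) (p : Fin n) (u : ℕ) : ℕ :=
  Nat.count (fun w => E.event w = some (.invoke p .increment)) u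

/-- The contribution of an operation to the number of Increments. -/
def CounterInv.weight : CounterInv → ℕ
  | .increment => 1
  | .read => 0

theorem Execution.numInc_succ_of_invoke {A : Implementation M CounterInv CounterRes}
    (E : Execution A n) {p : Fin n} {i : CounterInv} {u : ℕ}
    (h : E.event u = some (.invoke p i)) : E.numInc p (u + 1) = E.numInc p u + i.weight := by
  cases i <;> simp [Execution.numInc, Nat.count_succ, h, CounterInv.weight]

theorem Execution.numInc_succ_of_ne {A : Implementation M CounterInv CounterRes}
    (E : Execution A n) {p : Fin n} {u : ℕ}
    (h : ∀ i, E.event u ≠ some (.invoke p i)) : E.numInc p (u + 1) = E.numInc p u := by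
  simp [Execution.numInc, Nat.count_succ, h]

theorem Execution.numInc_eq_ncard {A : Implementation M CounterInv CounterRes}
    (E : Execution A n) (p : Fin n) (u : ℕ) :
    E.numInc p u = {w | w < u ∧ E.event w = some (.invoke p .increment)}.ncard := by
  classical
  rw [Execution.numInc, Nat.count_eq_card_filter_range, ← Set.ncard_coe_finset]
  congr 1
  ext w
  simp

theorem Execution.IncrementsAtMost.numInc_le {A : Implementation M CounterInv CounterRes}
    {E : Execution A n} {m : ℕ} (h : E.IncrementsAtMost m) (p : Fin n) (u : ℕ) :
    E.numInc p u ≤ m := by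
  rw [E.numInc_eq_ncard]
  have h1 : {w | w < u ∧ E.event w = some (.invoke p .increment)}.encard ≤ m :=
    (Set.encard_le_encard (t := {t | ∃ p, E.event t = some (.invoke p .increment)})
      fun w hw => ⟨p, hw.2⟩).trans h
  rw [← Set.Finite.cast_ncard_eq ((Set.finite_Iio u).subset fun w hw => hw.1)] at h1
  exact_mod_cast h1

/-- Sequential programs for at most `m` Increments per process, verified under the assumption that
all steps are contained in `R`: when the process has invoked `c` Increments, its local variables
satisfy `L · c` between operations, its accesses satisfy `G c`, and `Post i c s` describes the
outcome of an operation `i` which is invoked, after `c` Increments, when the memory is `s`. -/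
structure Verified (init : Local) (prog : CounterInv → Local → Prog M (CounterRes × Local)) (m : ℕ)
    (R : M.State → M.State → Prop) (G : ℕ → M.Op → Prop) (L : Local → ℕ → Prop)
    (Post : CounterInv → ℕ → M.State → CounterRes × Local → M.State → Prop) : Prop where
  refl : ∀ s, R s s
  trans : ∀ s₁ s₂ s₃, R s₁ s₂ → R s₂ s₃ → R s₁ s₃
  rely : ∀ c o s, G c o → R s (M.apply o s).2
  init : L init 0
  meets : ∀ i l c s, L l c → c + i.weight ≤ m →
    (prog i l).Meets R (G (c + i.weight)) (Post i c s) s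
  post : ∀ i c s a s', Post i c s a s' → L a.2 (c + i.weight)

namespace Verified

variable {prog : CounterInv → Local → Prog M (CounterRes × Local)} {m : ℕ}
  {R : M.State → M.State → Prop} {G : ℕ → M.Op → Prop} {L : Local → ℕ → Prop}
  {Post : CounterInv → ℕ → M.State → CounterRes × Local → M.State → Prop}

theorem invariant (h : Verified init prog m R G L Post)
    (E : Execution (.ofProg Local init prog) n) (hE : E.IncrementsAtMost m) (u : ℕ) (p : Fin n) :
    (∀ l : Local, (E.config u).status p = .idle l → L l (E.numInc p u)) ∧
    (∀ c : Prog M (CounterRes × Local), (E.config u).status p = .busy c →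
      c.Meets R (G (E.numInc p u)) (fun a _ => L a.2 (E.numInc p u)) (E.config u).mem) := by
  induction u generalizing p with
  | zero =>
    rw [E.config_zero]
    refine ⟨fun l hl => ?_, fun c hc => ?_⟩
    · cases hl
      simpa [Execution.numInc, Implementation.ofProg] using h.init
    · cases hc
  | succ u ih =>
    rcases E.cases_at u with ⟨he, hc⟩ | ⟨q, i, l, he, hs, hm, hst⟩ | ⟨q, o, cont, he, hs, hm, hst⟩ |
      ⟨q, r, l, he, hs, hm, hst⟩
    · rw [hc, E.numInc_succ_of_ne (by simp [he])]
      exact ih p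
    · rw [hm, hst]
      rcases eq_or_ne p q with rfl | hpq
      · rw [Function.update_self]
        refine ⟨fun l' hl' => (by cases hl'), fun c hc => ?_⟩
        cases hc
        have hle := hE.numInc_le p (u + 1)
        rw [E.numInc_succ_of_invoke he] at hle ⊢
        exact (h.meets i l _ _ ((ih p).1 l hs) hle).mono fun a s ha => h.post _ _ _ _ _ ha
      · rw [Function.update_of_ne hpq, E.numInc_succ_of_ne (by simp [he, hpq.symm])]
        exact ih p
    · rw [hm, hst, E.numInc_succ_of_ne (by simp [he])]
      have hq := (ih q).2 _ hs
      rcases eq_or_ne p q with rfl | hpq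
      · rw [Function.update_self]
        refine ⟨fun l' hl' => (by cases hl'), fun c hc => ?_⟩
        cases hc
        exact hq.2 _ (h.refl _)
      · rw [Function.update_of_ne hpq]
        exact ⟨(ih p).1, fun c hc => ((ih p).2 c hc).of_rely h.trans (h.rely _ _ _ hq.1)⟩
    · rw [hm, hst, E.numInc_succ_of_ne (by simp [he])]
      have hq := (ih q).2 _ hs
      rcases eq_or_ne p q with rfl | hpq
      · rw [Function.update_self]
        refine ⟨fun l' hl' => ?_, fun c hc => (by cases hc)⟩
        cases hl'
        exact hq _ (h.refl _)
      · rw [Function.update_of_ne hpq]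
        exact ih p

theorem access (h : Verified init prog m R G L Post)
    (E : Execution (.ofProg Local init prog) n) (hE : E.IncrementsAtMost m) {u : ℕ} {p : Fin n}
    {o : M.Op} (he : E.event u = some (.access p o)) : G (E.numInc p u) o := by
  rcases E.cases_at u with ⟨he', _⟩ | ⟨q, i, l, he', hs, hm, hst⟩ |
    ⟨q, o, cont, he', hs, hm, hst⟩ | ⟨q, r, l, he', hs, hm, hst⟩
  all_goals rw [he'] at he; cases he
  exact ((h.invariant E hE u _).2 _ hs).1

theorem mem_succ (h : Verified init prog m R G L Post)
    (E : Execution (.ofProg Local init prog) n) (hE : E.IncrementsAtMost m) (u : ℕ) :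
    R (E.config u).mem (E.config (u + 1)).mem := by
  rcases E.cases_at u with ⟨_, hc⟩ | ⟨q, i, l, he', hs, hm, hst⟩ |
    ⟨q, o, cont, he', hs, hm, hst⟩ | ⟨q, r, l, he', hs, hm, hst⟩
  · rw [hc]; exact h.refl _
  · rw [hm]; exact h.refl _
  · rw [hm]; exact h.rely _ _ _ (h.access E hE he')
  · rw [hm]; exact h.refl _

theorem running (h : Verified init prog m R G L Post)
    (E : Execution (.ofProg Local init prog) n) (hE : E.IncrementsAtMost m) {p : Fin n}
    {i : CounterInv} {t u : ℕ} (ht : E.event t = some (.invoke p i)) (hu : E.Running p t u) :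
    ∃ c : Prog M (CounterRes × Local), (E.config u).status p = .busy c ∧
      c.Meets R (G (E.numInc p t + i.weight)) (Post i (E.numInc p t) (E.config t).mem)
        (E.config u).mem := by
  obtain ⟨htu, hu⟩ := hu
  induction u, htu using Nat.le_induction with
  | base =>
    rcases E.cases_at t with ⟨he, _⟩ | ⟨q, i, l, he, hs, hm, hst⟩ |
      ⟨q, o, cont, he, hs, hm, hst⟩ | ⟨q, r, l, he, hs, hm, hst⟩
    all_goals rw [he] at ht; cases ht
    rw [hm, hst, Function.update_self]
    refine ⟨_, rfl, ?_⟩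
    have hle := hE.numInc_le p (t + 1)
    rw [E.numInc_succ_of_invoke he] at hle
    exact h.meets i l _ _ ((h.invariant E hE t p).1 l hs) hle
  | succ u htu ih =>
    obtain ⟨c, hc, hmeets⟩ := ih fun w hw hw' => hu w hw (hw'.trans u.lt_succ_self)
    have hmono := h.mem_succ E hE u
    rcases E.cases_at u with ⟨he, hcfg⟩ | ⟨q, i, l, he, hs, hm, hst⟩ |
      ⟨q, o, cont, he, hs, hm, hst⟩ | ⟨q, r, l, he, hs, hm, hst⟩
    · exact ⟨c, by rw [hcfg]; exact hc, hmeets.of_rely h.trans hmono⟩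
    · refine ⟨c, ?_, hmeets.of_rely h.trans hmono⟩
      rw [hst, Function.update_of_ne, hc]
      rintro rfl
      rw [hc] at hs
      cases hs
    · rcases eq_or_ne p q with rfl | hpq
      · rw [hc] at hs
        cases hs
        rw [hm, hst, Function.update_self]
        exact ⟨_, rfl, hmeets.2 _ (h.refl _)⟩
      · exact ⟨c, by rw [hst, Function.update_of_ne hpq]; exact hc, hmeets.of_rely h.trans hmono⟩
    · refine ⟨c, ?_, hmeets.of_rely h.trans hmono⟩
      rw [hst, Function.update_of_ne, hc]
      rintro rfl
      exact hu u htu u.lt_succ_self r he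

theorem completes (h : Verified init prog m R G L Post)
    (E : Execution (.ofProg Local init prog) n) (hE : E.IncrementsAtMost m) {p : Fin n}
    {i : CounterInv} {t s : ℕ} {r : CounterRes} (ht : E.event t = some (.invoke p i))
    (hs : E.Completes t s r) :
    ∃ l, Post i (E.numInc p t) (E.config t).mem (r, l) (E.config s).mem := by
  obtain ⟨p', i', ht', hts, hres, hrun⟩ := hs
  rw [ht] at ht'
  cases ht'
  obtain ⟨c, hc, hmeets⟩ := h.running E hE ht ⟨hts, hrun⟩
  rcases E.cases_at s with ⟨he, hcfg⟩ | ⟨q, i, l, he, hs, hm, hst⟩ |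
    ⟨q, o, cont, he, hs, hm, hst⟩ | ⟨q, r, l, he, hs, hm, hst⟩
  all_goals rw [he] at hres; cases hres
  rw [hc] at hs
  cases hs
  exact ⟨l, hmeets _ (h.refl _)⟩

/-- The operations of a process do not overlap. -/
theorem exists_completes (h : Verified init prog m R G L Post)
    (E : Execution (.ofProg Local init prog) n) (hE : E.IncrementsAtMost m) {p : Fin n}
    {i i' : CounterInv} {t t' : ℕ} (ht : E.event t = some (.invoke p i))
    (ht' : E.event t' = some (.invoke p i')) (htt : t < t') :
    ∃ s r, s < t' ∧ E.Completes t s r := by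
  classical
  by_cases hrun : E.Running p t t'
  · obtain ⟨c, hc, -⟩ := h.running E hE ht hrun
    rcases E.cases_at t' with ⟨he, hcfg⟩ | ⟨q, i, l, he, hs, hm, hst⟩ |
      ⟨q, o, cont, he, hs, hm, hst⟩ | ⟨q, r, l, he, hs, hm, hst⟩
    all_goals rw [he] at ht'; cases ht'
    rw [hc] at hs
    cases hs
  · have hex : ∃ s, t < s ∧ s < t' ∧ ∃ r, E.event s = some (.respond p r) := by
      by_contra hno
      push Not at hno
      exact hrun ⟨htt, hno⟩
    obtain ⟨h1, h2, r, h3⟩ := Nat.find_spec hex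
    refine ⟨Nat.find hex, r, h2, p, i, ht, h1, h3, fun u hu hu' r' hr' => ?_⟩
    exact Nat.find_min hex hu' ⟨hu, hu'.trans h2, r', hr'⟩

end Verified

end Counter

/-- The local variables of a process that has invoked and completed `c` Increments. -/
def LocalVars.Counts (l : LocalVars) (c : ℕ) : Prop :=
  (l = .initial ∧ c = 0) ∨
    ∃ v, l.nextVal = v + 1 ∧ l.threshold = 2 ^ v ∧ c = 2 ^ v + l.lcounter ∧ l.lcounter < 2 ^ v

theorem LocalVars.Counts.eq_threshold {l : LocalVars} {c : ℕ} (h : l.Counts c)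
    (hl : l.lcounter + 1 = l.threshold) : c + 1 = 2 ^ l.nextVal := by
  obtain ⟨rfl, rfl⟩ | ⟨v, h1, h2, h3, h4⟩ := h
  · rfl
  · rw [h1, h3, pow_succ]
    omega

theorem LocalVars.Counts.write {l : LocalVars} {c : ℕ} (h : l.Counts c)
    (hl : l.lcounter + 1 = l.threshold) :
    LocalVars.Counts
      { lcounter := 0
        threshold := if 2 ≤ l.nextVal + 1 then 2 * l.threshold else l.threshold
        nextVal := l.nextVal + 1 } (c + 1) := by
  have h0 := h.eq_threshold hl
  refine .inr ⟨l.nextVal, rfl, ?_, by simpa using h0, by positivity⟩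
  obtain ⟨rfl, rfl⟩ | ⟨v, h1, h2, h3, h4⟩ := h
  · simp [LocalVars.initial]
  · simp only [h1, h2, pow_succ]
    rw [if_pos (by omega)]
    ring

theorem LocalVars.Counts.lt_pow {l : LocalVars} {c : ℕ} (h : l.Counts c)
    (hl : l.lcounter + 1 ≠ l.threshold) (j : ℕ) : c + 1 ≠ 2 ^ j := by
  obtain ⟨rfl, rfl⟩ | ⟨v, h1, h2, h3, h4⟩ := h
  · exact absurd rfl hl
  · intro hj
    have h5 : 2 ^ v < 2 ^ j := by omega
    have h6 : 2 ^ j < 2 ^ (v + 1) := by rw [pow_succ]; omega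
    have := (Nat.pow_lt_pow_iff_right (by norm_num : 1 < 2)).1 h5
    have := (Nat.pow_lt_pow_iff_right (by norm_num : 1 < 2)).1 h6
    omega

theorem LocalVars.Counts.noWrite {l : LocalVars} {c : ℕ} (h : l.Counts c)
    (hl : l.lcounter + 1 ≠ l.threshold) :
    LocalVars.Counts { l with lcounter := l.lcounter + 1 } (c + 1) := by
  obtain ⟨rfl, rfl⟩ | ⟨v, h1, h2, h3, h4⟩ := h
  · exact absurd rfl hl
  · exact .inr ⟨v, h1, h2, by simp only; omega, by simp only; omega⟩

/-- The value returned by a Read that finds `a - 1` in the max-register. -/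
noncomputable def readout (k : ℝ) : ℕ → ℝ
  | 0 => 0
  | j + 1 => k * 2 ^ j

theorem readout_eq (k : ℝ) (a : ℕ) :
    (if 0 ≤ (a : ℤ) - 1 then k * (2 : ℝ) ^ ((a : ℤ) - 1) else 0) = readout k a := by
  cases a with
  | zero => simp [readout]
  | succ j => simp [readout]

theorem verified_counterOnMaxRegister (k : ℝ) (m : ℕ) :
    Verified (M := maxRegister) .initial (counterProg k) m (fun _ _ => True)
      (fun c (o : MaxRegOp) => ∀ v, o = .maxWrite v → ∃ j : ℕ, v = j ∧ c = 2 ^ j)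
      LocalVars.Counts (fun i c _ a _ => a.2.Counts (c + i.weight)) where
  refl _ := trivial
  trans _ _ _ _ _ := trivial
  rely _ _ _ _ := trivial
  init := .inl ⟨rfl, rfl⟩
  post _ _ _ _ _ h := h
  meets i l c s h _ := by
    cases i with
    | increment =>
      rw [counterProg, incrementProg]
      by_cases hl : l.lcounter + 1 = l.threshold
      · rw [if_pos hl]
        refine ⟨fun v hv => ?_, fun _ _ _ _ => h.write hl⟩
        cases hv
        exact ⟨l.nextVal, rfl, h.eq_threshold hl⟩
      · rw [if_neg hl]
        exact fun _ _ => h.noWrite hl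
    | read => exact ⟨fun v hv => (by cases hv), fun _ _ _ _ => h⟩

theorem verified_counterOnRegisters (k : ℝ) (m : ℕ) :
    Verified (M := registers (Node (treeDepth (Nat.clog 2 m)))) .initial
      (fun i s => (counterProg k i s).subst (maxRegisterProc (Nat.clog 2 m))) m Grows
      (fun c (o : RegOp (Node (treeDepth (Nat.clog 2 m)))) => ∀ x b, o = .write x b →
        b = true ∧ ∃ v, 2 ^ v = c ∧ nodeMin _ x ≤ v + 1)
      LocalVars.Counts
      (fun i c s a s' => match i with
        | .increment => a.2.Counts (c + 1) ∧ a.1 = .ack ∧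
            ∀ j, 2 ^ j = c + 1 → j + 1 ≤ treeVal (treeDepth (Nat.clog 2 m)) s'
        | .read => a.2.Counts c ∧ ∃ y, treeVal (treeDepth (Nat.clog 2 m)) s ≤ y ∧
            y ≤ treeVal (treeDepth (Nat.clog 2 m)) s' ∧ a.1 = .value (readout k y)) where
  refl := Grows.refl
  trans := Grows.trans
  rely c o s h := by
    obtain x | ⟨x, b⟩ := (o : RegOp _)
    · exact Grows.refl _
    · obtain ⟨rfl, -⟩ := h x b rfl
      exact Grows.update s x
  init := .inl ⟨rfl, rfl⟩
  post i _ _ _ _ h := by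
    cases i
    · exact h.1
    · exact h.1
  meets i l c s h hm := by
    cases i with
    | increment =>
      rw [counterProg, incrementProg]
      by_cases hl : l.lcounter + 1 = l.threshold
      · rw [if_pos hl]
        have h2 := h.eq_threshold hl
        refine Prog.Meets.bind Grows.refl ((meets_treeMaxWrite (fun x => ?_) _ id
          (l.nextVal + 1) ?_ (fun y hy => ?_) s).mono ?_)
        · exact fun _ _ h => by cases h
        · have h3 : l.nextVal ≤ Nat.clog 2 m := by
            have h4 : 2 ^ l.nextVal ≤ m := h2 ▸ hm
            calc l.nextVal = Nat.clog 2 (2 ^ l.nextVal) := by rw [Nat.clog_pow]; norm_num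
              _ ≤ _ := Nat.clog_mono_right 2 h4
          have h5 : Nat.clog 2 m + 2 ≤ 2 ^ treeDepth (Nat.clog 2 m) :=
            Nat.le_pow_clog (by norm_num) _
          omega
        · rintro x b hxb
          cases hxb
          exact ⟨rfl, l.nextVal, h2.symm, hy⟩
        · intro _ s₁ h1 s₂ hs₂
          refine ⟨h.write hl, rfl, fun j hj => ?_⟩
          have h3 := treeVal_le_of_grows id hs₂
          have h4 : j = l.nextVal := Nat.pow_right_injective le_rfl (hj.trans h2)
          rw [h4]
          exact h1.trans h3
      · rw [if_neg hl]
        exact fun _ _ => ⟨h.noWrite hl, rfl, fun j hj => absurd hj.symm (h.lt_pow hl j)⟩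
    | read =>
      refine Prog.Meets.bind Grows.refl (Prog.Meets.bind Grows.refl
        ((meets_treeMaxRead (fun x => ?_) _ id s).mono ?_))
      · exact fun _ _ h => by cases h
      · rintro y s₁ ⟨h1, h2, -⟩ s₂ hs₂ s₃ hs₃
        have h3 := treeVal_le_of_grows id (hs₂.trans _ _ _ hs₃)
        refine ⟨h, y, h1, h2.trans h3, ?_⟩
        exact congrArg _ (readout_eq k y)

theorem callsAtMost_counterOnRegisters (k : ℝ) (h : ℕ) (i : CounterInv) (l : LocalVars) :
    ((counterProg k i l).subst (maxRegisterProc h)).CallsAtMost (treeDepth h) := by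
  cases i with
  | increment =>
    rw [counterProg, incrementProg]
    by_cases hl : l.lcounter + 1 = l.threshold
    · rw [if_pos hl]
      exact (callsAtMost_treeMaxWrite _ _ _).bind (b := 0) fun _ => trivial
    · rw [if_neg hl]
      trivial
  | read =>
    refine Prog.CallsAtMost.bind (b := 0) ?_ fun _ => trivial
    exact Prog.CallsAtMost.bind (b := 0) (callsAtMost_treeMaxRead _ _) fun _ => trivial

/-! ### Sequential specifications along a linearization -/

theorem numIncrements_append (l l' : List (CounterInv × CounterRes)) :
    numIncrements (l ++ l') = numIncrements l + numIncrements l' := by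
  induction l with
  | nil => simp [numIncrements]
  | cons x l ih =>
    obtain ⟨_ | _, r⟩ := x
    · simp only [List.cons_append, numIncrements, ih]; omega
    · simp only [List.cons_append, numIncrements, ih]

theorem CounterSpec.append_singleton {k : ℝ} {l : List (CounterInv × CounterRes)}
    (hl : CounterSpec k l) {x : CounterInv × CounterRes}
    (hx : match x with
      | (.increment, res) => res = .ack
      | (.read, res) => ∃ y : ℝ, res = .value y ∧
          (numIncrements l : ℝ) / k ≤ y ∧ y ≤ k * (numIncrements l : ℝ)) :
    CounterSpec k (l ++ [x]) := by
  intro j hj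
  rcases Nat.lt_or_ge j l.length with hjl | hjl
  · rw [List.getElem_append_left hjl, List.take_append_of_le_length hjl.le]
    exact hl j hjl
  · obtain rfl : j = l.length := by simp at hj; omega
    obtain ⟨_ | _, r⟩ := x
    · simpa using hx
    · simpa using hx

open Classical in
/-- The number of Increments in a prefix of a linearization. -/
theorem numIncrements_filterMap_range (L : ℕ → Option ℕ) (lab : ℕ → CounterInv × CounterRes)
    (N : ℕ) :
    numIncrements (((List.range N).filterMap L).map lab) =
      ((Finset.range N).filter fun j => ∃ t, L j = some t ∧ (lab t).1 = .increment).card := by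
  induction N with
  | zero => rfl
  | succ N ih =>
    rw [List.range_succ, List.filterMap_append, List.map_append, numIncrements_append, ih,
      Finset.range_add_one, Finset.filter_insert]
    rcases hL : L N with _ | t
    · simp [hL, numIncrements]
    · rcases hlab : lab t with ⟨_ | _, r⟩
      · simp [hL, hlab, numIncrements]
      · simp [hL, hlab, numIncrements]

open Classical in
theorem counterSpec_filterMap_range {k : ℝ} {L : ℕ → Option ℕ}
    {lab : ℕ → CounterInv × CounterRes}
    (hack : ∀ j t, L j = some t → (lab t).1 = .increment → (lab t).2 = .ack)
    (hread : ∀ j t, L j = some t → (lab t).1 = .read → ∃ y : ℝ, (lab t).2 = .value y ∧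
      (((Finset.range j).filter fun j => ∃ t, L j = some t ∧ (lab t).1 = .increment).card : ℝ) / k
        ≤ y ∧
      y ≤ k *
        (((Finset.range j).filter fun j => ∃ t, L j = some t ∧ (lab t).1 = .increment).card : ℝ))
    (N : ℕ) : CounterSpec k (((List.range N).filterMap L).map lab) := by
  induction N with
  | zero => exact fun j hj => absurd hj (by simp)
  | succ N ih =>
    rw [List.range_succ, List.filterMap_append, List.map_append]
    rcases hL : L N with _ | t
    · simpa [hL] using ih
    · simp only [List.filterMap_cons, hL, List.filterMap_nil, List.map_cons, List.map_nil]
      refine ih.append_singleton ?_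
      have h1 := hack N t hL
      have h2 := hread N t hL
      rw [← numIncrements_filterMap_range] at h2
      rcases hlab : lab t with ⟨_ | _, r⟩
      · simpa [hlab] using h1
      · simpa [hlab] using h2

/-- A set of natural numbers `S` is listed in the order of a key function (and of the numbers
themselves, if the keys agree). -/
theorem exists_listing (S : Set ℕ) (key : ℕ → ℕ) (h : ∀ t ∈ S, t ≤ key t) :
    ∃ (L : ℕ → Option ℕ) (slot : ℕ → ℕ), (∀ j t, L j = some t ↔ t ∈ S ∧ j = slot t) ∧
      ∀ t ∈ S, ∀ t', key t < key t' → slot t < slot t' := by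
  classical
  refine ⟨fun j => if j - j.sqrt * j.sqrt ∈ S ∧ key (j - j.sqrt * j.sqrt) = j.sqrt then
    some (j - j.sqrt * j.sqrt) else none, fun t => key t * key t + t, fun j t => ?_, ?_⟩
  · simp only [Option.ite_none_right_eq_some, Option.some.injEq]
    constructor
    · rintro ⟨⟨h1, h2⟩, rfl⟩
      have := Nat.sqrt_le j
      refine ⟨h1, ?_⟩
      rw [h2]
      omega
    · rintro ⟨hS, rfl⟩
      rw [Nat.sqrt_add_eq _ (by have := h t hS; omega)]
      simp [hS]
  · intro t ht t' hlt
    have := h t ht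
    nlinarith

/-! ### Linearization by levels -/

section Levels

variable {M : SharedMemory} {n : ℕ} {A : Implementation M CounterInv CounterRes}

theorem Execution.Completes.unique {E : Execution A n} {t s s' : ℕ} {r r' : CounterRes}
    (h : E.Completes t s r) (h' : E.Completes t s' r') : s = s' ∧ r = r' := by
  obtain ⟨p, i, ht, hts, hs, hrun⟩ := h
  obtain ⟨p', i', ht', hts', hs', hrun'⟩ := h'
  rw [ht] at ht'
  cases ht'
  obtain hlt | rfl | hlt := lt_trichotomy s s'
  · exact absurd hs (hrun' s hts hlt r)
  · rw [hs] at hs'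
    cases hs'
    exact ⟨rfl, rfl⟩
  · exact absurd hs' (hrun s' hts' hlt r')

theorem Execution.numInc_mono (E : Execution A n) (p : Fin n) : Monotone (E.numInc p) :=
  fun _ _ h => by classical exact Nat.count_monotone _ h

theorem Execution.numInc_lt (E : Execution A n) {p : Fin n} {t t' : ℕ}
    (ht : E.event t = some (.invoke p .increment)) (h : t < t') :
    E.numInc p t < E.numInc p t' := by
  have h1 := E.numInc_succ_of_invoke ht
  have h2 : E.numInc p (t + 1) ≤ E.numInc p t' := E.numInc_mono p h
  simp only [CounterInv.weight] at h1
  omega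

theorem Execution.eq_of_numInc_eq (E : Execution A n) {p : Fin n} {t t' : ℕ}
    (ht : E.event t = some (.invoke p .increment)) (ht' : E.event t' = some (.invoke p .increment))
    (h : E.numInc p t = E.numInc p t') : t = t' := by
  obtain hlt | heq | hlt := lt_trichotomy t t'
  · exact absurd h (E.numInc_lt ht hlt).ne
  · exact heq
  · exact absurd h (E.numInc_lt ht' hlt).ne'

theorem Execution.exists_numInc_eq (E : Execution A n) {p : Fin n} {i u : ℕ}
    (h : i < E.numInc p u) :
    ∃ t < u, E.event t = some (.invoke p .increment) ∧ E.numInc p t = i := by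
  induction u with
  | zero => simp [Execution.numInc] at h
  | succ u ih =>
    by_cases hu : i < E.numInc p u
    · obtain ⟨t, ht, h1⟩ := ih hu
      exact ⟨t, ht.trans u.lt_succ_self, h1⟩
    · have he : E.event u = some (.invoke p .increment) := by
        by_contra he
        simp [Execution.numInc, Nat.count_succ, he] at h hu
        omega
      have h1 := E.numInc_succ_of_invoke he
      simp only [CounterInv.weight] at h1
      exact ⟨u, u.lt_succ_self, he, by omega⟩

/-- Accuracy of the value that is read at level `a`, when `N` Increments precede. -/
theorem readout_accurate {k : ℝ} (hk : Real.sqrt (2 * (n : ℝ)) ≤ k) {a N : ℕ}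
    (hupper : N ≤ n * (2 ^ a - 1)) (hlower : ∀ b, a = b + 1 → 2 ^ b ≤ N) :
    (N : ℝ) / k ≤ readout k a ∧ readout k a ≤ k * N := by
  have hk0 : 0 ≤ k := (Real.sqrt_nonneg _).trans hk
  have hk2 : 2 * (n : ℝ) ≤ k * k := by
    have := (Real.sqrt_le_left hk0).1 hk
    nlinarith
  cases a with
  | zero =>
    obtain rfl : N = 0 := by simpa using hupper
    simp [readout]
  | succ b =>
    have h1 : (2 : ℝ) ^ b ≤ N := by exact_mod_cast hlower b rfl
    have h2 : (N : ℝ) ≤ n * (2 * 2 ^ b) := by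
      have : N ≤ n * (2 * 2 ^ b) :=
        hupper.trans (Nat.mul_le_mul_left _ (by rw [pow_succ]; omega))
      exact_mod_cast this
    have h3 : (0 : ℝ) < 2 ^ b := by positivity
    refine ⟨div_le_of_le_mul₀ hk0 (by simp only [readout]; positivity) ?_, ?_⟩
    · simp only [readout]
      nlinarith
    · exact mul_le_mul_of_nonneg_left h1 hk0

theorem isLinearizable_of_levels (E : Execution A n) {k : ℝ}
    (hk : Real.sqrt (2 * (n : ℝ)) ≤ k) {U : ℕ → ℕ} {B : ℕ} (hU : Monotone U) (hB : ∀ t, U t ≤ B)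
    (hread : ∀ t p s r, E.event t = some (.invoke p .read) → E.Completes t s r →
      ∃ a, U t ≤ a ∧ a ≤ U s ∧ r = .value (readout k a))
    (hinc : ∀ t p s r, E.event t = some (.invoke p .increment) → E.Completes t s r →
      r = .ack ∧ ∀ j, 2 ^ j = E.numInc p t + 1 → j + 1 ≤ U s)
    (hlevel : ∀ t j, j + 1 ≤ U t → ∃ p, 2 ^ j ≤ E.numInc p t)
    (hseq : ∀ p i i' t t', E.event t = some (.invoke p i) → E.event t' = some (.invoke p i') →
      t < t' → ∃ s r, s < t' ∧ E.Completes t s r) :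
    E.IsLinearizable (CounterSpec k) := by
  classical
  have hlev : ∀ t, ∃ a,
      (∀ p, E.event t = some (.invoke p .read) → ∀ s r, E.Completes t s r →
        U t ≤ a ∧ a ≤ U s ∧ r = .value (readout k a)) ∧
      ∀ p, E.event t = some (.invoke p .increment) →
        (∀ j, 2 ^ j = E.numInc p t + 1 → a = j + 1) ∧
        ((∀ j, 2 ^ j ≠ E.numInc p t + 1) → a = 0) := by
    intro t
    by_cases hr : ∃ p s r, E.event t = some (.invoke p .read) ∧ E.Completes t s r
    · obtain ⟨p, s, r, ht, hs⟩ := hr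
      obtain ⟨a, ha⟩ := hread t p s r ht hs
      refine ⟨a, fun p' _ s' r' hs' => ?_, fun p' ht' => ?_⟩
      · obtain ⟨rfl, rfl⟩ := hs.unique hs'
        exact ha
      · rw [ht] at ht'
        cases ht'
    · by_cases hw : ∃ p j, E.event t = some (.invoke p .increment) ∧ 2 ^ j = E.numInc p t + 1
      · obtain ⟨p, j, ht, hj⟩ := hw
        refine ⟨j + 1, fun p' ht' s r hs => absurd ⟨p', s, r, ht', hs⟩ hr, fun p' ht' => ?_⟩
        rw [ht] at ht'
        cases ht'
        exact ⟨fun j' hj' => by rw [Nat.pow_right_injective le_rfl (hj'.trans hj.symm)],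
          fun h => absurd hj (h j)⟩
      · exact ⟨0, fun p' ht' s r hs => absurd ⟨p', s, r, ht', hs⟩ hr,
          fun p' ht' => ⟨fun j hj => absurd ⟨p', j, ht', hj⟩ hw, fun _ => rfl⟩⟩
  choose lev hlevr hlevi using hlev
  -- the first time at which a level is reached
  set T : ℕ → ℕ := fun a => sInf {u | a ≤ U u} with hT
  have hT_le : ∀ {a u}, a ≤ U u → T a ≤ u := fun h => Nat.sInf_le h
  have hT_mem : ∀ {a u}, a ≤ U u → a ≤ U (T a) := fun {a u} h =>
    Nat.sInf_mem (s := {u | a ≤ U u}) ⟨u, h⟩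
  set P : ℕ → ℕ := fun t => max t (T (lev t)) with hP
  set sub : ℕ → ℕ := fun t => 2 * lev t + if ∃ p, E.event t = some (.invoke p .read) then 1 else 0
    with hsub
  set key : ℕ → ℕ := fun t => P t * (2 * B + 2) + sub t with hkey
  set S : Set ℕ := {t | (∃ p, E.event t = some (.invoke p .increment)) ∧ (∃ u, lev t ≤ U u) ∨
    (∃ p, E.event t = some (.invoke p .read)) ∧ ∃ s r, E.Completes t s r} with hS
  have hcomp : ∀ {t s r}, E.Completes t s r → t ∈ S ∧ lev t ≤ U s ∧ P t ≤ s := by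
    intro t s r hc
    have hc' := hc
    obtain ⟨p, i, ht, hts, -⟩ := hc'
    have h1 : lev t ≤ U s := by
      cases i with
      | read => exact (hlevr t p ht s r hc).2.1
      | increment =>
        by_cases hj : ∃ j, 2 ^ j = E.numInc p t + 1
        · obtain ⟨j, hj⟩ := hj
          rw [(hlevi t p ht).1 j hj]
          exact (hinc t p s r ht hc).2 j hj
        · rw [(hlevi t p ht).2 (not_exists.1 hj)]
          exact Nat.zero_le _
    refine ⟨?_, h1, max_le hts.le (hT_le h1)⟩
    cases i with
    | read => exact .inr ⟨⟨p, ht⟩, s, r, hc⟩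
    | increment => exact .inl ⟨⟨p, ht⟩, s, h1⟩
  have hreach : ∀ {t}, t ∈ S → ∃ u, lev t ≤ U u := by
    rintro t (⟨-, h⟩ | ⟨-, s, r, h⟩)
    · exact h
    · exact ⟨s, (hcomp h).2.1⟩
  have hkey_lt : ∀ {t t'}, t ∈ S → (P t < P t' ∨ P t ≤ P t' ∧ sub t < sub t') →
      key t < key t' := by
    intro t t' ht h
    obtain ⟨u, hu⟩ := hreach ht
    have h1 : sub t < 2 * B + 2 := by
      have := hu.trans (hB u)
      simp only [hsub]
      split_ifs <;> omega
    simp only [hkey]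
    rcases h with h | ⟨h, h'⟩
    · nlinarith
    · nlinarith
  obtain ⟨L, slot, hL, hslot⟩ := exists_listing S key fun t _ => by
    simp only [hkey, hP]
    nlinarith [le_max_left t (T (lev t))]
  have hslot_lt : ∀ {t t'}, t ∈ S → (P t < P t' ∨ P t ≤ P t' ∧ sub t < sub t') →
      slot t < slot t' := fun ht h => hslot _ ht _ (hkey_lt ht h)
  have horder : ∀ {t s r t'}, E.Completes t s r → s < t' → slot t < slot t' := fun hc hst =>
    hslot_lt (hcomp hc).1 (.inl ((hcomp hc).2.2.trans_lt (hst.trans_le (le_max_left _ _))))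
  have hsame : ∀ {p t t'}, E.event t = some (.invoke p .increment) →
      E.event t' = some (.invoke p .increment) → t ≤ t' → t' ∈ S →
      t ∈ S ∧ slot t ≤ slot t' := by
    intro p t t' ht ht' hle hmem
    rcases hle.eq_or_lt with rfl | hlt
    · exact ⟨hmem, le_rfl⟩
    · obtain ⟨s, r, hst, hc⟩ := hseq p _ _ t t' ht ht' hlt
      exact ⟨(hcomp hc).1, (horder hc hst).le⟩
  set lab : ℕ → CounterInv × CounterRes := fun t =>
    if ∃ p, E.event t = some (.invoke p .read) then (.read, .value (readout k (lev t)))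
    else (.increment, .ack) with hlab
  have hlab_read : ∀ {t p}, E.event t = some (.invoke p .read) →
      lab t = (.read, .value (readout k (lev t))) := fun {t p} h => if_pos ⟨p, h⟩
  have hnot_read : ∀ {t p}, E.event t = some (.invoke p .increment) →
      ¬ ∃ p, E.event t = some (.invoke p .read) := by
    rintro t p h ⟨p', h'⟩
    rw [h] at h'
    cases h'
  have hlab_inc : ∀ {t p}, E.event t = some (.invoke p .increment) →
      lab t = (.increment, .ack) := fun {t p} h => if_neg (hnot_read h)
  have hsub_read : ∀ {t p}, E.event t = some (.invoke p .read) → sub t = 2 * lev t + 1 :=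
    fun {t p} h => by simp only [hsub]; rw [if_pos ⟨p, h⟩]
  have hsub_inc : ∀ {t p}, E.event t = some (.invoke p .increment) → sub t = 2 * lev t :=
    fun {t p} h => by simp only [hsub]; rw [if_neg (hnot_read h), add_zero]
  refine ⟨L, lab, fun j t hj => ?_, fun i j t hi hj => ?_, fun t s r hc => ⟨?_, ?_⟩,
    fun t₁ s r t₂ i j hc hst hi hj => ?_, counterSpec_filterMap_range ?_ ?_⟩
  · obtain ⟨⟨⟨p, ht⟩, -⟩ | ⟨⟨p, ht⟩, -⟩, -⟩ := (hL j t).1 hj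
    · exact ⟨p, by rw [hlab_inc ht, ht]⟩
    · exact ⟨p, by rw [hlab_read ht, ht]⟩
  · rw [((hL i t).1 hi).2, ((hL j t).1 hj).2]
  · exact ⟨slot t, (hL _ t).2 ⟨(hcomp hc).1, rfl⟩⟩
  · have hc' := hc
    obtain ⟨p, _ | _, ht, -⟩ := hc'
    · rw [hlab_inc ht, (hinc t p s r ht hc).1]
    · rw [hlab_read ht, (hlevr t p ht s r hc).2.2]
  · rw [((hL i t₁).1 hi).2, ((hL j t₂).1 hj).2]
    exact horder hc hst
  · intro j t hj hl
    obtain ⟨⟨⟨p, ht⟩, -⟩ | ⟨⟨p, ht⟩, -⟩, -⟩ := (hL j t).1 hj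
    · rw [hlab_inc ht]
    · rw [hlab_read ht] at hl
      cases hl
  · intro N t hN hl
    obtain ⟨htS, rfl⟩ := (hL N t).1 hN
    obtain ⟨⟨p, ht⟩, -⟩ | ⟨⟨p, ht⟩, s, r, hc⟩ := id htS
    · rw [hlab_inc ht] at hl
      cases hl
    obtain ⟨h1, h2, -⟩ := hlevr t p ht s r hc
    rw [hlab_read ht]
    refine ⟨_, rfl, readout_accurate hk ?_ ?_⟩
    · calc _ ≤ ((Finset.univ : Finset (Fin n)) ×ˢ Finset.range (2 ^ lev t - 1)).card := ?_
        _ = n * (2 ^ lev t - 1) := by simp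
      refine Finset.card_le_card_of_forall_subsingleton (fun j q => ∃ x, L j = some x ∧
        E.event x = some (.invoke q.1 .increment) ∧ q.2 = E.numInc q.1 x) ?_ ?_
      · intro j hj
        obtain ⟨hjN, x, hjx, hx⟩ := Finset.mem_filter.1 hj
        obtain ⟨hxS, rfl⟩ := (hL j x).1 hjx
        obtain ⟨⟨q, hxq⟩, -⟩ | ⟨⟨q, hxq⟩, -⟩ := id hxS
        · refine ⟨(q, E.numInc q x), ?_, x, hjx, hxq, rfl⟩
          simp only [Finset.mem_product, Finset.mem_univ, true_and, Finset.mem_range]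
          by_contra hcon
          have h3 : 1 ≤ 2 ^ lev t := Nat.one_le_two_pow
          have h4 := E.numInc_lt hxq (Nat.lt_add_one x)
          obtain ⟨y, hyx, hy, hyn⟩ := E.exists_numInc_eq (p := q) (i := 2 ^ lev t - 1)
            (u := x + 1) (by omega)
          obtain ⟨hyS, hyslot⟩ := hsame hy hxq (Nat.lt_succ_iff.1 hyx) hxS
          have hly : lev y = lev t + 1 := (hlevi y q hy).1 _ (by omega)
          obtain ⟨u, hu⟩ := hreach hyS
          have h5 : lev t + 1 ≤ U (T (lev t + 1)) := hly ▸ hT_mem hu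
          have h6 : t < T (lev t + 1) := by
            by_contra hlt
            have := hU (not_lt.1 hlt)
            omega
          have h7 : P t ≤ P y := by
            refine le_trans (max_le h6.le (hT_le (by omega))) ?_
            rw [← hly]
            exact le_max_right _ _
          have h8 := hslot_lt htS (.inr ⟨h7, by rw [hsub_read ht, hsub_inc hy, hly]; omega⟩)
          rw [Finset.mem_range] at hjN
          omega
        · rw [hlab_read hxq] at hx
          cases hx
      · rintro ⟨q, i⟩ - j ⟨-, x, hjx, hx, hxi⟩ j' ⟨-, x', hjx', hx', hxi'⟩
        obtain rfl := E.eq_of_numInc_eq hx hx' (hxi.symm.trans hxi')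
        rw [((hL j x).1 hjx).2, ((hL j' x).1 hjx').2]
    · intro b hb
      rw [hb] at h2
      obtain ⟨q, hq⟩ := hlevel _ b (hT_mem h2)
      have h3 : 1 ≤ 2 ^ b := Nat.one_le_two_pow
      obtain ⟨y, hyT, hy, hyn⟩ := E.exists_numInc_eq (p := q) (i := 2 ^ b - 1)
        (u := T (b + 1)) (by omega)
      have hly : lev y = b + 1 := (hlevi y q hy).1 _ (by omega)
      have hyS : y ∈ S := .inl ⟨⟨q, hy⟩, s, by rw [hly]; exact h2⟩
      have h4 : slot y < slot t := by
        refine hslot_lt hyS (.inr ⟨?_, by rw [hsub_read ht, hsub_inc hy, hly, hb]; omega⟩)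
        simp only [hP, hly, hb]
        exact max_le (hyT.le.trans (le_max_right _ _)) (le_max_right _ _)
      rw [← Finset.card_range (2 ^ b)]
      refine Finset.card_le_card_of_forall_subsingleton (fun i j => ∃ x, L j = some x ∧
        E.event x = some (.invoke q .increment) ∧ i = E.numInc q x) ?_ ?_
      · intro i hi
        rw [Finset.mem_range] at hi
        obtain ⟨x, hxT, hx, hxn⟩ := E.exists_numInc_eq (hi.trans_le hq)
        have hxy : x ≤ y := by
          by_contra hlt
          have := E.numInc_lt hy (not_le.1 hlt)
          omega
        obtain ⟨hxS, hxslot⟩ := hsame hx hy hxy hyS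
        have hLx := (hL _ x).2 ⟨hxS, rfl⟩
        refine ⟨slot x, Finset.mem_filter.2 ⟨Finset.mem_range.2 (by omega), x, hLx, ?_⟩,
          x, hLx, hx, hxn.symm⟩
        rw [hlab_inc hx]
      · rintro j - i ⟨-, x, hjx, hx, rfl⟩ i' ⟨-, x', hjx', hx', rfl⟩
        rw [hjx] at hjx'
        cases hjx'
        rfl

end Levels

/-! ### Step complexity -/

theorem finite_and_ncard_le_of_count_le {S : Set ℕ} [DecidablePred (· ∈ S)] {B : ℕ}
    (h : ∀ u, Nat.count (· ∈ S) u ≤ B) : S.Finite ∧ S.ncard ≤ B := by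
  have hfin : S.Finite := by
    by_contra hinf
    have h1 := h (Nat.nth (· ∈ S) (B + 1))
    rw [Nat.count_nth_of_infinite (p := (· ∈ S)) hinf] at h1
    omega
  refine ⟨hfin, ?_⟩
  obtain ⟨u, hu⟩ := hfin.bddAbove
  refine le_trans (le_of_eq ?_) (h (u + 1))
  rw [Nat.count_eq_card_filter_range, ← Set.ncard_coe_finset]
  congr 1
  ext w
  simp only [Finset.coe_filter, Finset.mem_range, Set.mem_ofPred_eq]
  exact ⟨fun hw => ⟨Nat.lt_succ_of_le (hu hw), hw⟩, fun hw => hw.2⟩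

section Steps

variable {M : SharedMemory} {Inv Res Local : Type} {init : Local} {n : ℕ}
  {prog : Inv → Local → Prog M (Res × Local)} {N : ℕ}

/-- The times of the steps of `p` from time `t` up to its next response. -/
def Execution.stepsFrom {A : Implementation M Inv Res} (E : Execution A n) (p : Fin n) (t : ℕ) :
    Set ℕ :=
  {u | t ≤ u ∧ (∃ e, E.event u = some e ∧ e.proc = p) ∧
    ∀ w, t ≤ w → w < u → ∀ r, E.event w ≠ some (.respond p r)}

theorem Execution.callsAtMost_of_busy (hN : ∀ i l, (prog i l).CallsAtMost N)
    (E : Execution (.ofProg Local init prog) n) (p : Fin n) (u : ℕ) (c : Prog M (Res × Local))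
    (hc : (E.config u).status p = .busy c) : c.CallsAtMost N := by
  induction u generalizing c with
  | zero =>
    rw [E.config_zero] at hc
    cases hc
  | succ u ih =>
    rcases E.cases_at u with ⟨he, hcfg⟩ | ⟨q, i, l, he, hs, hm, hst⟩ |
      ⟨q, o, cont, he, hs, hm, hst⟩ | ⟨q, r, l, he, hs, hm, hst⟩
    · rw [hcfg] at hc
      exact ih c hc
    all_goals
      rw [hst] at hc
      rcases eq_or_ne p q with rfl | hpq
      on_goal 2 =>
        rw [Function.update_of_ne hpq] at hc
        exact ih c hc
      rw [Function.update_self] at hc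
      cases hc
    · exact hN i l
    · obtain _ | N := N
      · exact (ih _ hs).elim
      · exact Prog.CallsAtMost.mono (ih _ hs _) N.le_succ

theorem Execution.stepsFrom_finite (E : Execution (.ofProg Local init prog) n) {p : Fin n} {t : ℕ}
    {c : Prog M (Res × Local)} (hc : (E.config t).status p = .busy c) (hN : c.CallsAtMost N) :
    (E.stepsFrom p t).Finite ∧ (E.stepsFrom p t).ncard ≤ N + 1 := by
  classical
  refine finite_and_ncard_le_of_count_le fun u => ?_
  have hzero : ∀ u ≤ t, Nat.count (· ∈ E.stepsFrom p t) u = 0 := by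
    intro u hu
    rw [Nat.count_eq_card_filter_range, Finset.card_eq_zero, Finset.filter_eq_empty_iff]
    intro w hw hmem
    rw [Finset.mem_range] at hw
    have := hmem.1
    omega
  rcases Nat.lt_or_ge u t with hut | htu
  · rw [hzero u hut.le]
    exact Nat.zero_le _
  have key : (∃ (c : Prog M (Res × Local)) (K : ℕ), (E.config u).status p = .busy c ∧
      c.CallsAtMost K ∧ Nat.count (· ∈ E.stepsFrom p t) u + K ≤ N) ∨
      ((∃ v r, t ≤ v ∧ v < u ∧ E.event v = some (.respond p r)) ∧
        Nat.count (· ∈ E.stepsFrom p t) u ≤ N + 1) := by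
    induction u, htu using Nat.le_induction with
    | base => exact .inl ⟨c, N, hc, hN, by rw [hzero t le_rfl, zero_add]⟩
    | succ u htu ih =>
      rw [Nat.count_succ]
      rcases ih with ⟨c, K, hc, hK, hle⟩ | ⟨⟨v, r, htv, hvu, hv⟩, hle⟩
      · have hstay : (∀ e, E.event u = some e → e.proc ≠ p) → u ∉ E.stepsFrom p t :=
          fun h ⟨_, ⟨e, he, hp⟩, _⟩ => h e he hp
        rcases E.cases_at u with ⟨he, hcfg⟩ | ⟨q, i, l, he, hs, hm, hst⟩ |
          ⟨q, o, cont, he, hs, hm, hst⟩ | ⟨q, r, l, he, hs, hm, hst⟩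
        · left
          rw [if_neg (hstay (by simp [he])), hcfg]
          exact ⟨c, K, hc, hK, hle⟩
        all_goals rcases eq_or_ne p q with rfl | hpq
        all_goals try
          left
          rw [if_neg (hstay (by simp [he, Event.proc, hpq.symm])), hst,
            Function.update_of_ne hpq]
          exact ⟨c, K, hc, hK, hle⟩
        · rw [hc] at hs
          cases hs
        · left
          rw [hc] at hs
          cases hs
          obtain _ | K := K
          · exact hK.elim
          · refine ⟨_, K, by rw [hst, Function.update_self], hK _, ?_⟩
            split_ifs <;> omega
        · right
          refine ⟨⟨u, r, htu, u.lt_succ_self, he⟩, ?_⟩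
          split_ifs <;> omega
      · right
        refine ⟨⟨v, r, htv, hvu.trans u.lt_succ_self, hv⟩, ?_⟩
        rw [if_neg fun h => h.2.2 v htv hvu r hv]
        exact hle
  rcases key with ⟨_, K, -, -, h⟩ | ⟨-, h⟩ <;> omega

theorem Execution.opSteps_finite (hN : ∀ i l, (prog i l).CallsAtMost N)
    (E : Execution (.ofProg Local init prog) n) {p : Fin n} {i : Inv} {t : ℕ}
    (ht : E.event t = some (.invoke p i)) :
    (E.opSteps p t).Finite ∧ (E.opSteps p t).ncard ≤ N + 2 := by
  obtain ⟨c, hc⟩ : ∃ c : Prog M (Res × Local), (E.config (t + 1)).status p = .busy c := by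
    rcases E.cases_at t with ⟨he, hcfg⟩ | ⟨q, i, l, he, hs, hm, hst⟩ |
      ⟨q, o, cont, he, hs, hm, hst⟩ | ⟨q, r, l, he, hs, hm, hst⟩
    all_goals rw [he] at ht; cases ht
    exact ⟨_, by rw [hst, Function.update_self]⟩
  obtain ⟨hfin, hcard⟩ := E.stepsFrom_finite hc (E.callsAtMost_of_busy hN p _ c hc)
  have hsub : E.opSteps p t ⊆ insert t (E.stepsFrom p (t + 1)) := by
    rintro u ⟨htu, hu, hrun⟩
    rcases htu.eq_or_lt with rfl | hlt
    · exact Set.mem_insert _ _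
    · exact .inr ⟨hlt, hu, fun w hw => hrun w hw⟩
  refine ⟨(hfin.insert t).subset hsub, ?_⟩
  calc _ ≤ (insert t (E.stepsFrom p (t + 1))).ncard := Set.ncard_le_ncard hsub (hfin.insert t)
    _ ≤ _ := Set.ncard_insert_le _ _
    _ ≤ _ := by omega

theorem isWaitFree_ofProg (hN : ∀ i l, (prog i l).CallsAtMost N) :
    (Implementation.ofProg Local init prog).IsWaitFree n := by
  intro E p hinf
  by_contra hfin
  rw [Set.not_infinite] at hfin
  obtain ⟨s, hs⟩ := hfin.bddAbove
  obtain ⟨u, ⟨e, he, hep⟩, hsu⟩ := hinf.exists_gt s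
  obtain ⟨c, hc⟩ : ∃ c : Prog M (Res × Local), (E.config (u + 1)).status p = .busy c := by
    rcases E.cases_at u with ⟨he', hcfg⟩ | ⟨q, i, l, he', hs, hm, hst⟩ |
      ⟨q, o, cont, he', hs, hm, hst⟩ | ⟨q, r, l, he', hs', hm, hst⟩
    all_goals
      rw [he'] at he
      cases he
    all_goals
      obtain rfl : q = p := hep
    · exact ⟨_, by rw [hst, Function.update_self]⟩
    · exact ⟨_, by rw [hst, Function.update_self]⟩
    · exact absurd (hs ⟨r, he'⟩) (not_le.2 hsu)
  obtain ⟨hfin', -⟩ := E.stepsFrom_finite hc (E.callsAtMost_of_busy hN p _ c hc)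
  refine hinf (((Set.finite_Iic u).union hfin').subset fun w hw => ?_)
  rcases Nat.lt_or_ge u w with h | h
  · exact .inr ⟨h, hw, fun v hv _ r hr => absurd (hs ⟨r, hr⟩) (by omega)⟩
  · exact .inl h

end Steps

theorem treeDepth_le (m : ℕ) :
    (treeDepth (Nat.clog 2 m) : ℝ) + 2 ≤ 6 * max 1 (Real.logb 2 (Real.logb 2 (m : ℝ))) := by
  rcases Nat.lt_or_ge m 3 with hm | hm
  · have h1 : Nat.clog 2 m ≤ 1 := Nat.clog_le_of_le_pow (by omega)
    have h2 : treeDepth (Nat.clog 2 m) ≤ 2 := Nat.clog_le_of_le_pow (by omega)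
    have h3 : (treeDepth (Nat.clog 2 m) : ℝ) ≤ 2 := by exact_mod_cast h2
    have h4 := le_max_left 1 (Real.logb 2 (Real.logb 2 (m : ℝ)))
    linarith
  · have clog_le : ∀ x : ℕ, 1 ≤ x → (Nat.clog 2 x : ℝ) ≤ Real.logb 2 x + 1 := by
      intro x hx
      rw [← Real.natCeil_logb_natCast]
      have h0 : 0 ≤ Real.logb 2 (x : ℝ) :=
        Real.logb_nonneg (by norm_num) (by exact_mod_cast hx)
      exact_mod_cast (Nat.ceil_lt_add_one h0).le
    have hm' : (2 : ℝ) ≤ m := by exact_mod_cast (by omega : 2 ≤ m)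
    have h1 : 1 ≤ Real.logb 2 (m : ℝ) := by
      rw [Real.le_logb_iff_rpow_le (by norm_num) (by linarith)]
      simpa using hm'
    have h2 := clog_le m (by omega)
    have h3 := clog_le (Nat.clog 2 m + 2) (by omega)
    have h4 : Real.logb 2 ((Nat.clog 2 m + 2 : ℕ) : ℝ) ≤
        Real.logb 2 (2 ^ 2 * Real.logb 2 (m : ℝ)) := by
      refine Real.logb_le_logb_of_le (by norm_num) (by positivity) ?_
      push_cast
      linarith
    rw [Real.logb_mul (by norm_num) (by linarith), Real.logb_pow,
      Real.logb_self_eq_one (by norm_num)] at h4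
    have h5 := le_max_left 1 (Real.logb 2 (Real.logb 2 (m : ℝ)))
    have h6 := le_max_right 1 (Real.logb 2 (Real.logb 2 (m : ℝ)))
    rw [treeDepth]
    push_cast at h3 h4
    linarith

theorem isLinearizableBoundedCounter_counterOnRegisters (n m : ℕ) {k : ℝ}
    (hk : Real.sqrt (2 * (n : ℝ)) ≤ k) :
    IsLinearizableBoundedCounter (counterOnRegisters k m) n k m := by
  intro (E : Execution (.ofProg LocalVars .initial (fun i s =>
    (counterProg k i s).subst (maxRegisterProc (Nat.clog 2 m)))) n) hE
  have hV := verified_counterOnRegisters k m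
  have hmono : Monotone fun t => treeVal (treeDepth (Nat.clog 2 m)) (E.config t).mem :=
    monotone_nat_of_le_succ fun t => treeVal_mono _ (hV.mem_succ E hE t)
  have hbits : ∀ t x, (E.config t).mem x = true →
      ∃ p v, 2 ^ v ≤ E.numInc p t ∧ nodeMin (treeDepth (Nat.clog 2 m)) x ≤ v + 1 := by
    intro t x hx
    induction t with
    | zero =>
      rw [E.config_zero] at hx
      exact absurd hx Bool.false_ne_true
    | succ t ih =>
      by_cases hold : (E.config t).mem x = true
      · obtain ⟨p, v, hv, hxv⟩ := ih hold
        exact ⟨p, v, hv.trans (E.numInc_mono p t.le_succ), hxv⟩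
      · rcases E.cases_at t with ⟨he, hcfg⟩ | ⟨q, i, l, he, hs, hm, hst⟩ |
          ⟨q, o, cont, he, hs, hm, hst⟩ | ⟨q, r, l, he, hs, hm, hst⟩
        · rw [hcfg] at hx
          exact absurd hx hold
        · rw [hm] at hx
          exact absurd hx hold
        · rw [hm] at hx
          have hG := hV.access E hE he
          obtain y | ⟨y, b⟩ := (o : RegOp _)
          · exact absurd hx hold
          · obtain ⟨-, v, hv, hyv⟩ := hG y b rfl
            have hxy : x = y := by
              by_contra hne
              have hx' : Function.update (β := fun _ => Bool) (E.config t).mem y b x = true := hx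
              exact hold ((Function.update_of_ne hne _ _).symm.trans hx')
            exact ⟨q, v, hv.le.trans (E.numInc_mono q t.le_succ), hxy ▸ hyv⟩
        · rw [hm] at hx
          exact absurd hx hold
  refine isLinearizable_of_levels E hk hmono (fun t => (treeVal_lt _ _).le) ?_ ?_ ?_ ?_
  · intro t p s r ht hs
    obtain ⟨l, -, h⟩ := hV.completes E hE ht hs
    exact h
  · intro t p s r ht hs
    obtain ⟨l, -, h⟩ := hV.completes E hE ht hs
    exact h
  · intro t j hj
    obtain ⟨x, hx, hx'⟩ := exists_nodeMin_of_treeVal_pos _ (Nat.lt_of_lt_of_le j.succ_pos hj)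
    obtain ⟨p, v, hv, hxv⟩ := hbits t x hx
    exact ⟨p, le_trans (Nat.pow_le_pow_right two_pos (by omega)) hv⟩
  · exact fun p i i' t t' ht ht' hlt => hV.exists_completes E hE ht ht' hlt

end ApproxCounter

open ApproxCounter

theorem theorem1 :
    ∃ C : ℝ, ∀ (n m : ℕ) (k : ℝ), Real.sqrt (2 * (n : ℝ)) ≤ k →
      IsLinearizableBoundedCounter (counterOnRegisters k m) n k m ∧
      (counterOnRegisters k m).IsWaitFree n ∧
      -- every Read and every Increment takes `O(log log m)` steps
      (counterOnRegisters k m).StepsAtMost n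
        (C * max 1 (Real.logb 2 (Real.logb 2 (m : ℝ)))) ∧
      -- the max-register is `⌈log₂ m⌉`-bounded, and a process MaxWrites `j` during its
      -- `2 ^ j`-th Increment
      (∀ E : Execution (counterOnMaxRegister k) n, E.IncrementsAtMost m →
        ∀ (t : ℕ) (p : Fin n) (v : ℤ), E.event t = some (.access p (.maxWrite v)) →
          v ≤ (Nat.clog 2 m : ℤ) ∧
          ∃ j : ℕ, v = (j : ℤ) ∧
            {u | u < t ∧ E.event u = some (.invoke p .increment)}.ncard = 2 ^ j) := by
  refine ⟨6, fun n m k hk => ⟨isLinearizableBoundedCounter_counterOnRegisters n m hk,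
    isWaitFree_ofProg (callsAtMost_counterOnRegisters k _), fun E p i t ht => ?_,
    fun (E : Execution (.ofProg LocalVars .initial (counterProg k)) n) hE t p v hv => ?_⟩⟩
  · obtain ⟨hfin, hcard⟩ := Execution.opSteps_finite (callsAtMost_counterOnRegisters k _) E ht
    refine ⟨hfin, le_trans ?_ (treeDepth_le m)⟩
    exact_mod_cast hcard
  · obtain ⟨j, rfl, hj⟩ := (verified_counterOnMaxRegister k m).access E hE hv v rfl
    refine ⟨?_, j, rfl, by rw [← hj, E.numInc_eq_ncard]⟩
    have h1 : 2 ^ j ≤ m := hj ▸ hE.numInc_le p t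
    have h2 := Nat.clog_mono_right 2 h1
    rw [Nat.clog_pow _ _ (by norm_num)] at h2
    exact_mod_cast h2
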